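/- Let $V$ be a set and let $K$ be a (not necessarily finite or locally finite) abstract simplicial complex with vertices in $V$, i.e. a family of nonempty finite subsets of $V$, called faces, that contains every nonempty subset of each of its members. Let $|K|$ be its polyhedron: the set of all functions $x\colon V\to[0,\infty)$ that vanish outside some face of $K$ and satisfy $\sum_{v\in V}x(v)=1$, equipped with the metric topology, i.e. the topology of the metric $d(x,y)=\bigl(\sum_{v\in V}(x(v)-y(v))^2\bigr)^{1/2}$. Call a continuous map $g\colon X\to M$ from a compact metrizable space $X$ to a metrizable space $M$ a *Krasinkiewicz map* if every continuum (nonempty compact connected subset) $L\subset X$ is either contained in a fiber $g^{-1}(y)$, $y\in M$, or contains a connected component of a fiber of $g$. Call a metrizable space $M$ a *Krasinkiewicz space* if, for every compact metrizable space $X$, the Krasinkiewicz maps form a dense subset of the space $C(X,M)$ of continuous maps $X\to M$ with the topology of uniform convergence (with respect to any metric compatible with the topology of $M$; for compact $X$ the topology does not depend on this metric). Then the polyhedron $|K|$ of every such simplicial complex $K$ is a Krasinkiewicz space. -/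

import Mathlib

open scoped ENNReal

universe w u

/-- The set of points of the simplicial complex `K`, in barycentric coordinates: families
`x : V → ℝ` of nonnegative numbers which vanish off some face of `K` and add up to `1`.
They are taken inside `ℓ²(V)`, so that the distance between two points is
`(∑ v, (x v - y v) ^ 2) ^ (1 / 2)`. Elements of `V` need not all be vertices of `K`. -/
def PreAbstractSimplicialComplex.realization {V : Type*} (K : PreAbstractSimplicialComplex V) :
    Set (lp (fun _ : V => ℝ) 2) :=
  {x | (∀ v, 0 ≤ x v) ∧ ∃ s ∈ K.faces, (∀ v, v ∉ s → x v = 0) ∧ ∑ v ∈ s, x v = 1}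

/-- The polyhedron of the simplicial complex `K`: its underlying space with the metric topology,
that is, the topology of the `ℓ²`-distance of barycentric coordinates. -/
abbrev PreAbstractSimplicialComplex.Polyhedron {V : Type*} (K : PreAbstractSimplicialComplex V) :
    Type _ :=
  ↥K.realization

/-- A map `g` is a Krasinkiewicz map if every continuum `L` (nonempty compact connected set) in its
domain is contained in a fiber of `g` or contains a component of a fiber of `g`. -/
def IsKrasinkiewiczMap {X M : Type*} [TopologicalSpace X] [TopologicalSpace M] (g : C(X, M)) :
    Prop :=
  ∀ L : Set X, IsCompact L → IsConnected L →
    (∃ y : M, L ⊆ g ⁻¹' {y}) ∨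
      ∃ (y : M) (x : X), x ∈ g ⁻¹' {y} ∧ connectedComponentIn (g ⁻¹' {y}) x ⊆ L

/-- A metrizable space `M` is a Krasinkiewicz space if for every compactum (compact metrizable
space) `X` the Krasinkiewicz maps are dense in `C(X, M)`. As `X` is compact, Mathlib's topology on
`C(X, M)` is the topology of uniform convergence with respect to any compatible metric on `M`. -/
def IsKrasinkiewiczSpace (M : Type u) [TopologicalSpace M]
    [TopologicalSpace.MetrizableSpace M] : Prop :=
  ∀ (X : Type w) [TopologicalSpace X] [CompactSpace X] [TopologicalSpace.MetrizableSpace X],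
    Dense {g : C(X, M) | IsKrasinkiewiczMap g}

/-! For real functions on a compactum, the Krasinkiewicz property is generic. Folding a function
over a level, except near a closed set `A`, yields subcontinua near whose fold all fiber components
miss `A`, and this survives small perturbations (`fiberComponentsAvoid_of_fold`). Baire's theorem
over countably many sets `A` then gives a dense set of functions for which every continuum they
cross contains a fiber component. For a map `f` into the polyhedron, finitely many vertices carry
almost all the mass. Their coordinates, divided by their maximum, are approximated one by one by
such functions, preserving the values `0` and `1` exactly, and renormalized. Keeping `0` keeps each
point in its face; keeping `1` makes the normalization injective. So a fiber of the new map is an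
intersection of fibers of the real functions, and the property passes to it. -/

open Set Topology

/-! ### Generic real-valued functions on compacta -/

section FiberComponents

variable {X : Type*} [TopologicalSpace X]

/-- Boundary bumping: in a continuum `L`, the component of a superlevel set reaches its boundary. -/
theorem exists_mem_connectedComponentIn_eq [T2Space X] {L : Set X} (hLc : IsCompact L)
    (hL : IsPreconnected L) {f : X → ℝ} (hf : Continuous f) {t : ℝ} {x y : X} (hx : x ∈ L)
    (hxt : t ≤ f x) (hy : y ∈ L) (hyt : f y < t) :
    ∃ z ∈ connectedComponentIn (L ∩ {z | t ≤ f z}) x, f z = t := by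
  set F : Set X := L ∩ {z | t ≤ f z} with hF
  have hFc : IsCompact F := hLc.inter_right (isClosed_le continuous_const hf)
  have hxF : x ∈ F := ⟨hx, hxt⟩
  have : CompactSpace F := isCompact_iff_compactSpace.mp hFc
  rw [connectedComponentIn_eq_image hxF]
  by_contra! hcon
  have hZ : IsCompact {z : F | f z = t} :=
    (isClosed_eq (hf.comp continuous_subtype_val) continuous_const).isCompact
  have hempty : {z : F | f z = t} ∩
      ⋂ s : { s : Set F // IsClopen s ∧ (⟨x, hxF⟩ : F) ∈ s }, (s : Set F) = ∅ := by
    rw [← connectedComponent_eq_iInter_isClopen]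
    ext z
    simp only [mem_inter_iff, mem_ofPred_eq, mem_empty_iff_false, iff_false, not_and]
    exact fun h1 h2 => hcon z ⟨z, h2, rfl⟩ h1
  have : Nonempty { s : Set F // IsClopen s ∧ (⟨x, hxF⟩ : F) ∈ s } :=
    ⟨univ, isClopen_univ, mem_univ _⟩
  -- If the component, an intersection of clopen sets, missed the level `t`, then by compactness so
  -- would one clopen `D`; `D` would then be clopen in all of `L`.
  obtain ⟨⟨D, hDo, hxD⟩, hD⟩ := hZ.elim_directed_family_closed _
    (fun s => s.2.1.isClosed) hempty (by
      rintro ⟨s, hs, hxs⟩ ⟨r, hr, hxr⟩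
      exact ⟨⟨s ∩ r, hs.inter hr, hxs, hxr⟩, inter_subset_left, inter_subset_right⟩)
  obtain ⟨O, hO, hOD⟩ := isOpen_induced_iff.mp hDo.isOpen
  have hDc : IsClosed (Subtype.val '' D) :=
    (hFc.isClosed.isClosedMap_subtype_val) D hDo.isClosed
  have key : ∀ z ∈ L, z ∈ Subtype.val '' D ↔ z ∈ O ∧ t < f z := by
    intro z hz
    constructor
    · rintro ⟨z, hzD, rfl⟩
      have h1 : z ∈ Subtype.val ⁻¹' O := by rw [hOD]; exact hzD
      refine ⟨h1, lt_of_le_of_ne z.2.2 fun h => ?_⟩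
      have : z ∈ ({z : F | f z = t} ∩ D) := ⟨h.symm, hzD⟩
      rw [hD] at this
      exact this
    · rintro ⟨hzO, hzt⟩
      refine ⟨⟨z, hz, hzt.le⟩, ?_, rfl⟩
      rw [← hOD]
      exact hzO
  obtain ⟨z, hzL, hz1, hz2⟩ := hL (O ∩ {z | t < f z}) (Subtype.val '' D)ᶜ
    (hO.inter (isOpen_lt continuous_const hf)) hDc.isOpen_compl
    (fun z hz => by
      by_cases h : z ∈ Subtype.val '' D
      · exact Or.inl ((key z hz).1 h)
      · exact Or.inr h)
    ⟨x, hx, (key x hx).1 ⟨_, hxD, rfl⟩⟩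
    ⟨y, hy, fun h => (lt_asymm hyt ((key y hy).1 h).2)⟩
  exact hz2 ((key z hzL).2 hz1)

/-- The set `L` contains points at which `h` is at most `a` and at least `b`. -/
def Crosses (h : X → ℝ) (L : Set X) (a b : ℝ) : Prop :=
  (∃ x ∈ L, h x ≤ a) ∧ ∃ x ∈ L, b ≤ h x

/-- Every continuum `L` off `U` on which `h` crosses `[a, b]` has a subcontinuum on which `h`
crosses a smaller interval `[c, d]`, and whose points with value in `[c, d]` lie in components of
fibers of `h` that miss `A`. -/
def FiberComponentsAvoid (A U : Set X) (a b : ℝ) (h : X → ℝ) : Prop :=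
  ∀ L : Set X, IsCompact L → IsConnected L → Disjoint L U → Crosses h L a b →
    ∃ c d : ℝ, a ≤ c ∧ c < d ∧ d ≤ b ∧ ∃ L' ⊆ L, IsCompact L' ∧ IsConnected L' ∧
      Crosses h L' c d ∧ ∀ p ∈ L', h p ∈ Icc c d →
        Disjoint (connectedComponentIn (h ⁻¹' {h p}) p) A

theorem isCompact_connectedComponentIn [T2Space X] {F : Set X} (hF : IsCompact F) {x : X}
    (hx : x ∈ F) : IsCompact (connectedComponentIn F x) := by
  have : CompactSpace F := isCompact_iff_compactSpace.mp hF
  rw [connectedComponentIn_eq_image hx]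
  exact isClosed_connectedComponent.isCompact.image continuous_subtype_val

/-- Folding a function just above the level `a`, except near `A`, makes small perturbations of it
satisfy `FiberComponentsAvoid`. -/
theorem fiberComponentsAvoid_of_fold [T2Space X] {A U : Set X} {a b θ : ℝ} (hθ : 0 < θ)
    (hab : a + 7 * θ ≤ b) {f s h h' : X → ℝ} (hf : Continuous f) (hs0 : ∀ x ∈ A, s x = 0)
    (hs1 : ∀ x ∉ U, s x = 1) (hs : ∀ x, s x ∈ Icc (0 : ℝ) 1)
    (hh : ∀ x, h x = f x - s x * (4 * max 0 (θ - |f x - (a + 5 * θ)|)))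
    (hh' : ∀ x, |h' x - h x| ≤ θ / 2) : FiberComponentsAvoid A U a b h' := by
  have hle : ∀ x, h x ≤ f x := fun x => by
    rw [hh]
    have := mul_nonneg (hs x).1 (mul_nonneg zero_le_four (le_max_left 0 (θ - |f x - (a + 5 * θ)|)))
    linarith
  have hge : ∀ x, a + 4 * θ ≤ f x → a + θ ≤ h x := fun x hx => by
    rw [hh]
    have h0 := le_max_left 0 (θ - |f x - (a + 5 * θ)|)
    have h1 : s x * (4 * max 0 (θ - |f x - (a + 5 * θ)|)) ≤
        4 * max 0 (θ - |f x - (a + 5 * θ)|) := mul_le_of_le_one_left (by linarith) (hs x).2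
    rcases max_cases 0 (θ - |f x - (a + 5 * θ)|) with ⟨h2, _⟩ | ⟨h2, _⟩
    · linarith
    · have := neg_abs_le (f x - (a + 5 * θ))
      have := le_abs_self (f x - (a + 5 * θ))
      linarith
  -- The tent has height `4θ` and half-width `θ` about the level `a + 5θ`: it vanishes at `a + 4θ`,
  -- and off `U` it pulls `a + 5θ` down to `a + θ`.
  have heq : ∀ x, f x = a + 4 * θ → h x = a + 4 * θ := fun x hx => by
    rw [hh, hx, show a + 4 * θ - (a + 5 * θ) = -θ by ring, abs_neg, abs_of_pos hθ]
    simp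
  rintro L hLc hL hLU ⟨⟨y, hyL, hy⟩, x, hxL, hx⟩
  have hb := fun x => abs_le.mp (hh' x)
  have hxf : a + 6 * θ < f x := by have := hle x; have := hb x; linarith
  have hyf : f y < a + 4 * θ := by
    by_contra! hcon
    have := hge y hcon
    have := hb y
    linarith
  obtain ⟨z, hz, hzt⟩ := exists_mem_connectedComponentIn_eq (t := a + 4 * θ) hLc hL.isPreconnected
    hf hxL (by linarith) hyL hyf
  set F := L ∩ {z | a + 4 * θ ≤ f z} with hF
  have hFc : IsCompact F := hLc.inter_right (isClosed_le continuous_const hf)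
  have hxF : x ∈ F := ⟨hxL, by simp only [mem_ofPred_eq]; linarith⟩
  have hCF : connectedComponentIn F x ⊆ F := connectedComponentIn_subset F x
  -- The lower level is the bottom `a + θ` of the fold plus the error `θ / 2`; the upper one, even
  -- with that error, stays below `a + 4θ`.
  refine ⟨a + 3 / 2 * θ, a + 5 / 2 * θ, by linarith, by linarith, by linarith,
    connectedComponentIn F x, hCF.trans inter_subset_left,
    isCompact_connectedComponentIn hFc hxF, isConnected_connectedComponentIn_iff.mpr hxF,
    ⟨?_, x, mem_connectedComponentIn hxF, by linarith⟩, ?_⟩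
  · obtain ⟨q, hq, hqf⟩ := isPreconnected_connectedComponentIn.intermediate_value hz
      (mem_connectedComponentIn hxF) hf.continuousOn
      (show a + 5 * θ ∈ Icc (f z) (f x) from ⟨by linarith, by linarith⟩)
    refine ⟨q, hq, ?_⟩
    have h1 : h q = a + θ := by
      rw [hh, hs1 q (hLU.notMem_of_mem_left (hCF hq).1), hqf, sub_self, abs_zero, sub_zero,
        max_eq_right hθ.le]
      ring
    have := hb q
    linarith
  · rintro p hp ⟨hp1, hp2⟩
    have hhC : ∀ q ∈ connectedComponentIn (h' ⁻¹' {h' p}) p, h q < a + 4 * θ := fun q hq => by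
      have h1 : h' q = h' p := connectedComponentIn_subset (h' ⁻¹' {h' p}) p hq
      have := hb q
      linarith
    -- On `A` there is no fold, so a point of the fiber component in `A` has `f < a + 4θ`, while `f
    -- p ≥ a + 4θ`. The component would meet the level `f = a + 4θ`, where `h` is too large.
    rw [disjoint_left]
    intro q hq hqA
    have hqf : f q < a + 4 * θ := by
      have h1 := hhC q hq
      rw [hh, hs0 q hqA] at h1
      linarith
    obtain ⟨r, hr, hrf⟩ := isPreconnected_connectedComponentIn.intermediate_value hq
      (mem_connectedComponentIn rfl) hf.continuousOn
      (show a + 4 * θ ∈ Icc (f q) (f p) from ⟨hqf.le, (hCF hp).2⟩)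
    have := hhC r hr
    rw [heq r hrf] at this
    exact lt_irrefl _ this

theorem fiberComponentsAvoid_mem_residual [CompactSpace X] [T2Space X] {A U : Set X}
    (hA : IsClosed A) (hU : IsOpen U) (hAU : A ⊆ U) {a b : ℝ} (hab : a < b) :
    {h : C(X, ℝ) | FiberComponentsAvoid A U a b h} ∈ residual C(X, ℝ) := by
  refine Filter.mem_of_superset (residual_of_dense_open isOpen_interior ?_) interior_subset
  rw [Metric.dense_iff]
  intro f ε hε
  obtain ⟨s, hs0, hs1, hs⟩ := exists_continuous_zero_one_of_isClosed hA hU.isClosed_compl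
    (disjoint_compl_right_iff_subset.mpr hAU)
  obtain ⟨θ, hθ, hθ1, hθ2⟩ : ∃ θ : ℝ, 0 < θ ∧ a + 7 * θ ≤ b ∧ 4 * θ < ε :=
    ⟨min ((b - a) / 7) (ε / 5), lt_min (by linarith) (by linarith),
      by have := min_le_left ((b - a) / 7) (ε / 5); linarith,
      by have := min_le_right ((b - a) / 7) (ε / 5); linarith⟩
  let h : C(X, ℝ) := ⟨fun x => f x - s x * (4 * max 0 (θ - |f x - (a + 5 * θ)|)), by fun_prop⟩
  refine ⟨h, ?_, ?_⟩
  · rw [Metric.mem_ball]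
    refine lt_of_le_of_lt ((ContinuousMap.dist_le (by positivity)).mpr fun x => ?_) hθ2
    have h0 : 0 ≤ 4 * max 0 (θ - |f x - (a + 5 * θ)|) := by positivity
    have h1 : max 0 (θ - |f x - (a + 5 * θ)|) ≤ θ :=
      max_le hθ.le (by have := abs_nonneg (f x - (a + 5 * θ)); linarith)
    have h2 := mul_le_of_le_one_left h0 (hs x).2
    have h3 := mul_nonneg (hs x).1 h0
    rw [Real.dist_eq, show h x - f x = -(s x * (4 * max 0 (θ - |f x - (a + 5 * θ)|))) by
      simp [h], abs_neg, abs_of_nonneg h3]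
    linarith
  · rw [mem_interior_iff_mem_nhds]
    refine Filter.mem_of_superset (Metric.closedBall_mem_nhds h (half_pos hθ)) fun h' hh' => ?_
    rw [Metric.mem_closedBall, ContinuousMap.dist_le (by positivity)] at hh'
    exact fiberComponentsAvoid_of_fold hθ hθ1 f.continuous (fun x hx => hs0 hx)
      (fun x hx => hs1 hx) hs (fun _ => rfl) hh'

/-- Every continuum on which `h` crosses an interval contains a component of a fiber of `h` over
some point of this interval. -/
def HasCrossedFiberComponents (h : X → ℝ) : Prop :=
  ∀ (L : Set X) (a b : ℝ), IsCompact L → IsConnected L → a < b → Crosses h L a b →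
    ∃ p ∈ L, h p ∈ Icc a b ∧ connectedComponentIn (h ⁻¹' {h p}) p ⊆ L

/-- Handling the pairs in turn gives nested continua and intervals. A point `p` common to all stages
has a fiber component missing each `A n` with `U n` disjoint from `L`, and such `A n` cover the
complement of `L`. -/
theorem hasCrossedFiberComponents_of_fiberComponentsAvoid [T2Space X] {h : X → ℝ}
    (hh : Continuous h) (A U : ℕ → Set X)
    (hAU : ∀ (L : Set X) (q : X), IsClosed L → q ∉ L → ∃ n, q ∈ A n ∧ Disjoint L (U n))
    (H : ∀ n, ∀ a b : ℚ, a < b → FiberComponentsAvoid (A n) (U n) a b h) :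
    HasCrossedFiberComponents h := by
  intro L a b hLc hL hab hcross
  let S := {T : Set X × ℝ × ℝ // T.1 ⊆ L ∧ IsCompact T.1 ∧ IsConnected T.1 ∧ T.2.1 < T.2.2 ∧
    Crosses h T.1 T.2.1 T.2.2}
  have step : ∀ (n : ℕ) (T : S), ∃ T' : S, T'.1.1 ⊆ T.1.1 ∧ T.1.2.1 ≤ T'.1.2.1 ∧
      T'.1.2.2 ≤ T.1.2.2 ∧ (Disjoint L (U n) → ∀ p ∈ T'.1.1, h p ∈ Icc T'.1.2.1 T'.1.2.2 →
        Disjoint (connectedComponentIn (h ⁻¹' {h p}) p) (A n)) := by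
    rintro n ⟨⟨M, c, d⟩, hML, hMc, hM, hcd, ⟨x, hxM, hx⟩, y, hyM, hy⟩
    by_cases hd : Disjoint L (U n)
    · obtain ⟨a', ha', ha'd⟩ := exists_rat_btwn hcd
      obtain ⟨b', hb', hb'd⟩ := exists_rat_btwn ha'd
      obtain ⟨c', d', h1, h2, h3, L', hL', hL'c, hL'conn, hcr, hp⟩ :=
        H n a' b' (by exact_mod_cast hb') M hMc hM (hd.mono_left hML)
          ⟨⟨x, hxM, hx.trans ha'.le⟩, y, hyM, hb'd.le.trans hy⟩
      exact ⟨⟨⟨L', c', d'⟩, hL'.trans hML, hL'c, hL'conn, h2, hcr⟩, hL', ha'.le.trans h1,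
        h3.trans hb'd.le, fun _ => hp⟩
    · exact ⟨⟨⟨M, c, d⟩, hML, hMc, hM, hcd, ⟨x, hxM, hx⟩, y, hyM, hy⟩, Subset.rfl, le_rfl, le_rfl,
        fun h => absurd h hd⟩
  choose next h1 h2 h3 h4 using step
  let T : ℕ → S := fun n => Nat.rec ⟨⟨L, a, b⟩, Subset.rfl, hLc, hL, hab, hcross⟩ next n
  have hTs : ∀ n, T (n + 1) = next n (T n) := fun n => rfl
  let F : ℕ → Set X := fun n => (T n).1.1 ∩ h ⁻¹' Icc (T n).1.2.1 (T n).1.2.2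
  have hFc : ∀ n, IsCompact (F n) := fun n =>
    (T n).2.2.1.inter_right (isClosed_Icc.preimage hh)
  obtain ⟨p, hp⟩ := IsCompact.nonempty_iInter_of_sequence_nonempty_isCompact_isClosed F
    (fun n => by
      simp only [F, hTs]
      exact inter_subset_inter (h1 n _) (preimage_mono (Icc_subset_Icc (h2 n _) (h3 n _))))
    (fun n => by
      obtain ⟨⟨x, hx, hxa⟩, y, hy, hyb⟩ := (T n).2.2.2.2.2
      have hlt := (T n).2.2.2.2.1
      obtain ⟨z, hz, hzv⟩ := (T n).2.2.2.1.isPreconnected.intermediate_value hx hy hh.continuousOn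
        (show (T n).1.2.1 ∈ Icc (h x) (h y) from ⟨hxa, hlt.le.trans hyb⟩)
      exact ⟨z, hz, hzv.ge, hzv.le.trans hlt.le⟩)
    (hFc 0) (fun n => (hFc n).isClosed)
  rw [mem_iInter] at hp
  refine ⟨p, (hp 0).1, (hp 0).2, fun q hq => ?_⟩
  by_contra hqL
  obtain ⟨n, hqA, hn⟩ := hAU L q hLc.isClosed hqL
  exact disjoint_left.mp (h4 n (T n) hn p (hp (n + 1)).1 (hp (n + 1)).2) hq hqA

theorem dense_hasCrossedFiberComponents [CompactSpace X] [T2Space X] [SecondCountableTopology X] :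
    Dense {h : C(X, ℝ) | HasCrossedFiberComponents h} := by
  have hbasis := TopologicalSpace.isBasis_countableBasis X
  let P := {B : TopologicalSpace.countableBasis X × TopologicalSpace.countableBasis X //
    closure B.1.1 ⊆ B.2.1}
  have : Countable (TopologicalSpace.countableBasis X) :=
    (TopologicalSpace.countable_countableBasis X).to_subtype
  refine dense_of_mem_residual (Filter.mem_of_superset (x := ⋂ (B : P) (a : ℚ) (b : ℚ) (_ : a < b),
    {h : C(X, ℝ) | FiberComponentsAvoid (closure B.1.1.1) B.1.2.1 a b h}) ?_ ?_)
  · simp only [countable_iInter_mem]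
    intro B a b hab
    exact fiberComponentsAvoid_mem_residual isClosed_closure (hbasis.isOpen B.1.2.2) B.2
      (by exact_mod_cast hab)
  · intro h hh
    simp only [mem_iInter, mem_ofPred_eq] at hh
    have hP : ∀ (L : Set X) (q : X), IsClosed L → q ∉ L →
        ∃ B : P, q ∈ closure B.1.1.1 ∧ Disjoint L B.1.2.1 := by
      intro L q hL hq
      obtain ⟨B₂, hB₂, hqB₂, hB₂L⟩ := hbasis.exists_subset_of_mem_open
        (show q ∈ Lᶜ from hq) hL.isOpen_compl
      obtain ⟨B₁, hB₁, hqB₁, hB₁B₂⟩ := hbasis.exists_closure_subset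
        ((hbasis.isOpen hB₂).mem_nhds hqB₂)
      exact ⟨⟨⟨⟨B₁, hB₁⟩, ⟨B₂, hB₂⟩⟩, hB₁B₂⟩, subset_closure hqB₁,
        (disjoint_left.mpr fun x hxB hxL => hB₂L hxB hxL).symm⟩
    rcases isEmpty_or_nonempty P with hE | hE
    · intro L a b hLc hL _ ⟨⟨x, hx, _⟩, _⟩
      refine absurd (hP ∅ x isClosed_empty (notMem_empty x)) fun ⟨B, _⟩ => hE.elim B
    · obtain ⟨e, he⟩ := exists_surjective_nat P
      refine hasCrossedFiberComponents_of_fiberComponentsAvoid h.continuous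
        (fun n => closure (e n).1.1.1) (fun n => (e n).1.2.1) (fun L q hL hq => ?_)
        (fun n a b hab => hh (e n) a b hab)
      obtain ⟨B, hB⟩ := hP L q hL hq
      obtain ⟨n, rfl⟩ := he B
      exact ⟨n, hB⟩

/-- A function into `[0, 1]` can be approximated, relative to its fibers over `0` and `1`, by
functions such that every continuum contains a component of a fiber or lies in a fiber. -/
theorem exists_approx_fiberComponent_subset [CompactSpace X] [T2Space X]
    [SecondCountableTopology X] (f : C(X, ℝ)) (hf : ∀ x, f x ∈ Icc (0 : ℝ) 1) {ε : ℝ}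
    (hε : 0 < ε) :
    ∃ h : C(X, ℝ), (∀ x, h x ∈ Icc (0 : ℝ) 1) ∧ (∀ x, |h x - f x| ≤ ε) ∧
      (∀ x, f x = 0 → h x = 0) ∧ (∀ x, f x = 1 → h x = 1) ∧
      ∀ L : Set X, IsCompact L → IsConnected L → (∃ x ∈ L, ∃ y ∈ L, h x ≠ h y) →
        ∃ p ∈ L, connectedComponentIn (h ⁻¹' {h p}) p ⊆ L := by
  obtain ⟨θ, hθ, hθ1, hθ2⟩ : ∃ θ : ℝ, 0 < θ ∧ θ ≤ 1 / 4 ∧ 4 * θ ≤ ε :=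
    ⟨min (1 / 4) (ε / 4), lt_min (by norm_num) (by linarith), min_le_left _ _,
      by have := min_le_right (1 / 4) (ε / 4); linarith⟩
  obtain ⟨k, hk, hkd⟩ := (Metric.dense_iff.mp dense_hasCrossedFiberComponents) f θ hθ
  rw [mem_ofPred_eq] at hkd
  have hkf : ∀ x, |k x - f x| ≤ θ := fun x =>
    (ContinuousMap.dist_apply_le_dist x).trans (Metric.mem_ball.mp hk).le
  have hpos : 0 < 1 - 2 * θ := by linarith
  -- Stretching `[θ, 1 - θ]` onto `[0, 1]` and clamping absorbs the error of `k` at the values `0`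
  -- and `1`.
  let h : C(X, ℝ) := ⟨fun x => max 0 (min 1 ((k x - θ) / (1 - 2 * θ))), by fun_prop⟩
  have hh : ∀ x, h x = max 0 (min 1 ((k x - θ) / (1 - 2 * θ))) := fun _ => rfl
  have hzero : ∀ x, k x ≤ θ → h x = 0 := fun x hx => by
    rw [hh]
    exact max_eq_left ((min_le_right _ _).trans
      (div_nonpos_of_nonpos_of_nonneg (by linarith) hpos.le))
  have hone : ∀ x, 1 - θ ≤ k x → h x = 1 := fun x hx => by
    rw [hh, min_eq_left ((one_le_div hpos).mpr (by linarith))]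
    exact max_eq_right zero_le_one
  have hmid : ∀ x, θ ≤ k x → k x ≤ 1 - θ → h x = (k x - θ) / (1 - 2 * θ) := fun x h1 h2 => by
    rw [hh, min_eq_right ((div_le_one hpos).mpr (by linarith)),
      max_eq_right (div_nonneg (by linarith) hpos.le)]
  refine ⟨h, fun x => ⟨le_max_left _ _, max_le zero_le_one (min_le_left _ _)⟩, fun x => ?_,
    fun x hx => hzero x ?_, fun x hx => hone x ?_, fun L hLc hL hLne => ?_⟩
  · have h1 := abs_le.mp (hkf x)
    have h2 := hf x
    rcases le_total (k x) θ with h3 | h3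
    · rw [hzero x h3, abs_le]
      constructor <;> linarith [h2.1]
    rcases le_total (k x) (1 - θ) with h4 | h4
    · rw [hmid x h3 h4, div_sub' hpos.ne', abs_div, abs_of_pos hpos, div_le_iff₀ hpos, abs_le]
      constructor <;> nlinarith [h2.1, h2.2, h1.1, h1.2]
    · rw [hone x h4, abs_le]
      constructor <;> linarith [h2.2]
  · have := abs_le.mp (hkf x)
    linarith
  · have := abs_le.mp (hkf x)
    linarith
  · obtain ⟨x, hx, y, hy, hxy⟩ : ∃ x ∈ L, ∃ y ∈ L, h x < h y := by
      obtain ⟨x, hx, y, hy, hxy⟩ := hLne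
      rcases lt_or_gt_of_ne hxy with h1 | h1
      · exact ⟨x, hx, y, hy, h1⟩
      · exact ⟨y, hy, x, hx, h1⟩
    have hxk : k x < 1 - θ := by
      by_contra! hcon
      have h1 := hone x hcon
      have h2 : h y ≤ 1 := max_le zero_le_one (min_le_left _ _)
      linarith
    have hyk : θ < k y := by
      by_contra! hcon
      have h1 := hzero y hcon
      have h2 : 0 ≤ h x := le_max_left _ _
      linarith
    have hxyk : k x < k y := by
      by_contra! hcon
      refine absurd hxy (not_lt.mpr ?_)
      rw [hh, hh]
      gcongr
    -- Choosing the interval inside `(θ, 1 - θ)`, where the stretching is injective, makes the fiber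
    -- of `h` through `p` lie in a fiber of `k`.
    obtain ⟨a, ha, hab⟩ := exists_between
      (max_lt (lt_min hxyk hxk) (lt_min hyk (by linarith)) : max (k x) θ < min (k y) (1 - θ))
    obtain ⟨b, hb, hbu⟩ := exists_between hab
    obtain ⟨p, hpL, ⟨hp1, hp2⟩, hp⟩ := hkd L a b hLc hL hb
      ⟨⟨x, hx, (le_max_left _ _).trans ha.le⟩, y, hy, hbu.le.trans (min_le_left _ _)⟩
    have hp3 : θ < k p := (le_max_right _ _).trans_lt (ha.trans_le hp1)
    have hp4 : k p < 1 - θ := hp2.trans_lt (hbu.trans_le (min_le_right _ _))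
    refine ⟨p, hpL, (connectedComponentIn_mono p fun q hq => ?_).trans hp⟩
    have hq' : h q = h p := hq
    have hm := hmid p hp3.le hp4.le
    have hp0 : 0 < h p := by rw [hm]; exact div_pos (by linarith) hpos
    have hp5 : h p < 1 := by rw [hm, div_lt_one hpos]; linarith
    have hq1 : θ < k q := by
      by_contra! hcon
      rw [hzero q hcon] at hq'
      exact hp0.ne hq'
    have hq2 : k q < 1 - θ := by
      by_contra! hcon
      rw [hone q hcon] at hq'
      exact hp5.ne' hq'
    rw [hm, hmid q hq1.le hq2.le, div_left_inj' hpos.ne'] at hq'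
    show k q = k p
    linarith

end FiberComponents


/-! ### Barycentric coordinates and normalization -/

namespace PreAbstractSimplicialComplex

variable {V : Type*} {K : PreAbstractSimplicialComplex V}

theorem sum_le_one_of_mem_realization {x : lp (fun _ : V => ℝ) 2} (hx : x ∈ K.realization)
    (t : Finset V) : ∑ v ∈ t, x v ≤ 1 := by
  classical
  obtain ⟨h0, s, -, hs, hs1⟩ := hx
  calc ∑ v ∈ t, x v ≤ ∑ v ∈ t ∪ s, x v :=
        Finset.sum_le_sum_of_subset_of_nonneg Finset.subset_union_left fun v _ _ => h0 v
    _ = ∑ v ∈ s, x v :=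
        (Finset.sum_subset Finset.subset_union_right fun v _ hv => hs v hv).symm
    _ = 1 := hs1

/-- Since `(x v - y v) ^ 2 ≤ |x v - y v| * (x v + y v)` and the total mass is at most `2`, uniform
closeness of coordinates suffices, whatever the dimension. -/
theorem norm_sub_le_of_mem_realization {x y : lp (fun _ : V => ℝ) 2} (hx : x ∈ K.realization)
    (hy : y ∈ K.realization) {ε : ℝ} (hε : 0 ≤ ε) (h : ∀ v, |x v - y v| ≤ ε ^ 2 / 2) :
    ‖x - y‖ ≤ ε := by
  refine lp.norm_le_of_forall_sum_le (by norm_num) hε fun t => ?_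
  simp only [ENNReal.toReal_ofNat, Real.rpow_ofNat]
  calc ∑ v ∈ t, ‖(x - y) v‖ ^ 2 ≤ ∑ v ∈ t, ε ^ 2 / 2 * (x v + y v) := by
        refine Finset.sum_le_sum fun v _ => ?_
        rw [lp.coeFn_sub, Pi.sub_apply, Real.norm_eq_abs, sq]
        refine mul_le_mul (h v) ?_ (abs_nonneg _) (by positivity)
        have := hx.1 v
        have := hy.1 v
        rw [abs_le]
        constructor <;> linarith
    _ = ε ^ 2 / 2 * (∑ v ∈ t, x v + ∑ v ∈ t, y v) := by
        rw [← Finset.mul_sum, Finset.sum_add_distrib]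
    _ ≤ ε ^ 2 / 2 * (1 + 1) := by
        gcongr
        exacts [sum_le_one_of_mem_realization hx t, sum_le_one_of_mem_realization hy t]
    _ = ε ^ 2 := by ring

theorem continuous_coord (v : V) : Continuous fun x : K.Polyhedron => x.1 v :=
  (lp.evalCLM ℝ (fun _ : V => ℝ) 2 v).continuous.comp continuous_subtype_val

/-- Up to a small error, the barycentric coordinates of a map from a compact space are
concentrated on finitely many vertices. -/
theorem exists_finset_lt_sum {X : Type*} [TopologicalSpace X] [CompactSpace X]
    (f : C(X, K.Polyhedron)) {r : ℝ} (hr : r < 1) :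
    ∃ S : Finset V, ∀ x, r < ∑ v ∈ S, (f x).1 v := by
  classical
  choose s _ _ hs using fun x => (f x).2.2
  obtain ⟨t, ht⟩ := isCompact_univ.elim_finite_subcover
    (fun x => {y | r < ∑ v ∈ s x, (f y).1 v})
    (fun x => isOpen_lt continuous_const
      (continuous_finsetSum _ fun v _ => (continuous_coord v).comp f.continuous))
    (fun x _ => mem_iUnion.mpr ⟨x, by rw [mem_ofPred_eq, hs]; exact hr⟩)
  refine ⟨t.biUnion s, fun y => ?_⟩
  obtain ⟨x, hx, hy⟩ := mem_iUnion₂.mp (ht (mem_univ y))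
  exact lt_of_lt_of_le hy (Finset.sum_le_sum_of_subset_of_nonneg
    (Finset.subset_biUnion_of_mem s hx) fun v _ _ => (f y).2.1 v)

/-- A map that determines finitely many functions, on each of which continua that are not in a
fiber contain components of fibers, is a Krasinkiewicz map. -/
theorem _root_.isKrasinkiewiczMap_of_determines {X M ι : Type*} [TopologicalSpace X]
    [TopologicalSpace M] (g : C(X, M)) (h : ι → X → ℝ)
    (hgh : ∀ x y, g x = g y ↔ ∀ i, h i x = h i y)
    (H : ∀ i, ∀ L : Set X, IsCompact L → IsConnected L → (∃ x ∈ L, ∃ y ∈ L, h i x ≠ h i y) →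
        ∃ p ∈ L, connectedComponentIn (h i ⁻¹' {h i p}) p ⊆ L) : IsKrasinkiewiczMap g := by
  intro L hLc hL
  by_cases hcon : ∀ i, ∀ x ∈ L, ∀ y ∈ L, h i x = h i y
  · obtain ⟨x, hx⟩ := hL.nonempty
    exact Or.inl ⟨g x, fun y hy => (hgh y x).2 fun i => hcon i y hy x hx⟩
  · push Not at hcon
    obtain ⟨i, hi⟩ := hcon
    obtain ⟨p, -, hp⟩ := H i L hLc hL hi
    exact Or.inr ⟨g p, p, rfl,
      (connectedComponentIn_mono p fun q hq => (hgh q p).1 hq i).trans hp⟩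

/-- A finite family of coordinates with maximum `1` is determined by its normalization. -/
theorem eq_of_div_sum_eq {S : Finset V} {y z : V → ℝ} (hy : ∀ v, y v ∈ Icc (0 : ℝ) 1)
    (hz : ∀ v, z v ∈ Icc (0 : ℝ) 1) (hy1 : ∃ v ∈ S, y v = 1) (hz1 : ∃ v ∈ S, z v = 1)
    (h : ∀ v ∈ S, y v / ∑ w ∈ S, y w = z v / ∑ w ∈ S, z w) : ∀ v ∈ S, y v = z v := by
  have hpos : ∀ y : V → ℝ, (∀ v, y v ∈ Icc (0 : ℝ) 1) → (∃ v ∈ S, y v = 1) →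
      0 < ∑ w ∈ S, y w := fun y hy ⟨v, hv, hv1⟩ =>
    zero_lt_one.trans_le (hv1.ge.trans (Finset.single_le_sum (fun w _ => (hy w).1) hv))
  have hle : ∀ y z : V → ℝ, (∀ v, y v ∈ Icc (0 : ℝ) 1) → (∀ v, z v ∈ Icc (0 : ℝ) 1) →
      (∃ v ∈ S, y v = 1) → (∃ v ∈ S, z v = 1) →
      (∀ v ∈ S, y v / ∑ w ∈ S, y w = z v / ∑ w ∈ S, z w) → ∑ w ∈ S, z w ≤ ∑ w ∈ S, y w := by
    intro y z hy hz hy1 hz1 h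
    have hY := hpos y hy hy1
    have hZ := hpos z hz hz1
    -- Where `y v = 1`, the equal ratios give `∑ z = z v * ∑ y ≤ ∑ y`.
    obtain ⟨v, hv, hv1⟩ := hy1
    have h1 := h v hv
    rw [div_eq_div_iff hY.ne' hZ.ne', hv1, one_mul] at h1
    rw [h1]
    exact mul_le_of_le_one_left hY.le (hz v).2
  have hsum := le_antisymm (hle z y hz hy hz1 hy1 fun v hv => (h v hv).symm) (hle y z hy hz hy1 hz1 h)
  intro v hv
  have h1 := h v hv
  rwa [hsum, div_left_inj' (hpos z hz hz1).ne'] at h1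

/-- Normalizing a perturbation of the coordinates `a v / m` gives a perturbation of `a v`. -/
theorem abs_sub_div_sum_le {S : Finset V} {a y : V → ℝ} {m κ η : ℝ}
    (hm : 0 < m) (hm1 : m ≤ 1) (ha : ∀ v ∈ S, a v ≤ m) (ha0 : ∀ v ∈ S, 0 ≤ a v)
    (hsum : |∑ v ∈ S, a v - 1| ≤ κ)
    (hy : ∀ v ∈ S, |y v - a v / m| ≤ η) (hy1 : 1 ≤ ∑ w ∈ S, y w) :
    ∀ v ∈ S, |a v - y v / ∑ w ∈ S, y w| ≤ κ + (S.card + 1) * η := by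
  intro v hv
  set Y := ∑ w ∈ S, y w with hY
  have hY0 : 0 < Y := zero_lt_one.trans_le hy1
  have h1 : |m * Y - ∑ v ∈ S, a v| ≤ S.card * η := by
    rw [hY, Finset.mul_sum, ← Finset.sum_sub_distrib, ← nsmul_eq_mul]
    refine (Finset.abs_sum_le_sum_abs _ _).trans (Finset.sum_le_card_nsmul _ _ _ fun w hw => ?_)
    rw [show m * y w - a w = m * (y w - a w / m) by field_simp, abs_mul, abs_of_pos hm]
    exact (mul_le_of_le_one_left (abs_nonneg _) hm1).trans (hy w hw)
  have h2 : |m * Y - 1| ≤ κ + S.card * η := by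
    have := abs_sub_le (m * Y) (∑ v ∈ S, a v) 1
    linarith
  have h3 : a v - y v / Y = (a v / m * (m * Y - 1) - (y v - a v / m)) / Y := by
    field_simp
    ring
  rw [h3, abs_div, abs_of_pos hY0]
  refine (div_le_self (abs_nonneg _) hy1).trans ((abs_sub _ _).trans ?_)
  have h4 : |a v / m * (m * Y - 1)| ≤ |m * Y - 1| := by
    rw [abs_mul, abs_of_nonneg (div_nonneg (ha0 v hv) hm.le)]
    exact mul_le_of_le_one_left (abs_nonneg _) ((div_le_one hm).mpr (ha v hv))
  linarith [hy v hv]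

end PreAbstractSimplicialComplex

/-! ### Approximation of maps into the polyhedron -/

open PreAbstractSimplicialComplex in
theorem corollary3p2 (V : Type u) (K : PreAbstractSimplicialComplex V) :
    IsKrasinkiewiczSpace.{w, u} K.Polyhedron := by
  classical
  intro X _ _ _
  let _ := TopologicalSpace.metrizableSpaceMetric X
  rw [Metric.dense_iff]
  intro f ε hε
  rcases isEmpty_or_nonempty X with hX | hX
  · exact ⟨f, Metric.mem_ball_self hε, fun L _ hL => isEmptyElim hL.nonempty.some⟩
  obtain ⟨κ, hκ, hκ1, hκε⟩ : ∃ κ : ℝ, 0 < κ ∧ κ < 1 ∧ 2 * κ ≤ (ε / 2) ^ 2 / 2 :=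
    ⟨min (1 / 2) ((ε / 2) ^ 2 / 4), by positivity,
      (min_le_left _ _).trans_lt (by norm_num),
      by have := min_le_right (1 / 2) ((ε / 2) ^ 2 / 4); linarith⟩
  obtain ⟨S, hS⟩ := exists_finset_lt_sum f (show 1 - κ < 1 by linarith)
  have hSne : S.Nonempty := by
    rw [Finset.nonempty_iff_ne_empty]
    rintro rfl
    have := hS hX.some
    rw [Finset.sum_empty] at this
    linarith
  have hf0 : ∀ v x, 0 ≤ (f x).1 v := fun v x => (f x).2.1 v
  have hfc : ∀ v, Continuous fun x => (f x).1 v := fun v =>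
    (continuous_coord v).comp f.continuous
  let m : X → ℝ := fun x => S.sup' hSne fun v => (f x).1 v
  have hmc : Continuous m := Continuous.finset_sup'_apply hSne fun v _ => hfc v
  have hfm : ∀ v ∈ S, ∀ x, (f x).1 v ≤ m x := fun v hv x =>
    Finset.le_sup' (fun v => (f x).1 v) hv
  have hmax : ∀ x, ∃ v ∈ S, m x = (f x).1 v := fun x => Finset.exists_mem_eq_sup' hSne _
  have hm0 : ∀ x, 0 < m x := by
    intro x
    by_contra! hcon
    have h1 := Finset.sum_nonpos fun v (hv : v ∈ S) => (hfm v hv x).trans hcon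
    linarith [hS x]
  have hm1 : ∀ x, m x ≤ 1 := fun x => by
    obtain ⟨v, -, hv⟩ := hmax x
    simpa [hv] using sum_le_one_of_mem_realization (f x).2 {v}
  -- With this `η` the error `κ + (S.card + 1) * η` of the normalization is `2 * κ`. A coordinate
  -- outside `S` is below `κ`.
  let η : ℝ := κ / (S.card + 1)
  have hη : 0 < η := by positivity
  have key : ∀ v : S, ∃ h : C(X, ℝ), (∀ x, h x ∈ Icc (0 : ℝ) 1) ∧
      (∀ x, |h x - (f x).1 v / m x| ≤ η) ∧ (∀ x, (f x).1 v = 0 → h x = 0) ∧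
      (∀ x, (f x).1 v = m x → h x = 1) ∧
      ∀ L : Set X, IsCompact L → IsConnected L → (∃ x ∈ L, ∃ y ∈ L, h x ≠ h y) →
        ∃ p ∈ L, connectedComponentIn (h ⁻¹' {h p}) p ⊆ L := by
    intro v
    obtain ⟨h, h1, h2, h3, h4, h5⟩ := exists_approx_fiberComponent_subset
      (⟨fun x => (f x).1 v / m x, (hfc v).div hmc fun x => (hm0 x).ne'⟩ : C(X, ℝ))
      (fun x => ⟨div_nonneg (hf0 v x) (hm0 x).le, (div_le_one (hm0 x)).mpr (hfm v v.2 x)⟩) hη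
    refine ⟨h, h1, h2, fun x hx => h3 x ?_, fun x hx => h4 x ?_, h5⟩
    · simp [hx]
    · simp [hx, (hm0 x).ne']
  choose h' h1' h2' h3' h4' h5 using key
  let h : V → X → ℝ := fun v x => if hv : v ∈ S then h' ⟨v, hv⟩ x else 0
  have hh : ∀ v (hv : v ∈ S), h v = h' ⟨v, hv⟩ := fun v hv => by
    funext x
    simp [h, hv]
  have hc : ∀ v ∈ S, Continuous (h v) := fun v hv => by
    rw [hh v hv]
    exact (h' ⟨v, hv⟩).continuous
  have h1 : ∀ v x, h v x ∈ Icc (0 : ℝ) 1 := fun v x => by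
    by_cases hv : v ∈ S
    · rw [hh v hv]
      exact h1' _ x
    · simp [h, hv]
  have h3 : ∀ v x, (f x).1 v = 0 → h v x = 0 := fun v x hx => by
    by_cases hv : v ∈ S
    · rw [hh v hv]
      exact h3' ⟨v, hv⟩ x hx
    · simp [h, hv]
  have hone : ∀ x, ∃ v ∈ S, h v x = 1 := fun x => by
    obtain ⟨v, hv, hvm⟩ := hmax x
    refine ⟨v, hv, ?_⟩
    rw [hh v hv]
    exact h4' ⟨v, hv⟩ x hvm.symm
  let Y : X → ℝ := fun x => ∑ v ∈ S, h v x
  have hY1 : ∀ x, 1 ≤ Y x := fun x => by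
    obtain ⟨v, hv, hv1⟩ := hone x
    exact hv1.ge.trans (Finset.single_le_sum (f := fun v => h v x) (fun w _ => (h1 w x).1) hv)
  have hY0 : ∀ x, Y x ≠ 0 := fun x => (zero_lt_one.trans_le (hY1 x)).ne'
  have hYc : Continuous Y := continuous_finsetSum _ hc
  let g₀ : X → lp (fun _ : V => ℝ) 2 := fun x =>
    ∑ v ∈ S, (h v x / Y x) • lp.single (E := fun _ : V => ℝ) 2 v 1
  have hg₀c : Continuous g₀ := continuous_finsetSum _ fun v hv =>
    ((hc v hv).div hYc hY0).smul continuous_const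
  have hg₀ : ∀ x v, g₀ x v = h v x / Y x := fun x v => by
    simp only [g₀, lp.coeFn_sum, Finset.sum_apply, lp.coeFn_smul, Pi.smul_apply, smul_eq_mul,
      lp.single_apply, Pi.single_apply, mul_ite, mul_one, mul_zero, Finset.sum_ite_eq]
    split_ifs with hv
    · rfl
    · simp [h, hv]
  have hg₀K : ∀ x, g₀ x ∈ K.realization := by
    intro x
    obtain ⟨-, s, hs, hs0, -⟩ := (f x).2
    -- A face carrying `f x` also carries `g₀ x`, because zero coordinates stay zero.
    refine ⟨fun v => ?_, s, hs, fun v hv => ?_, ?_⟩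
    · rw [hg₀]
      exact div_nonneg (h1 v x).1 (zero_le_one.trans (hY1 x))
    · rw [hg₀, h3 v x (hs0 v hv), zero_div]
    · simp only [hg₀]
      rw [← Finset.sum_div, div_eq_one_iff_eq (hY0 x)]
      calc ∑ v ∈ s, h v x = ∑ v ∈ s ∪ S, h v x :=
            Finset.sum_subset Finset.subset_union_left fun v _ hv => h3 v x (hs0 v hv)
        _ = ∑ v ∈ S, h v x :=
            (Finset.sum_subset Finset.subset_union_right fun v _ hv => by simp [h, hv]).symm
  let g : C(X, K.Polyhedron) := ⟨fun x => ⟨g₀ x, hg₀K x⟩, hg₀c.subtype_mk _⟩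
  refine ⟨g, ?_, ?_⟩
  · rw [Metric.mem_ball']
    refine lt_of_le_of_lt ((ContinuousMap.dist_le (half_pos hε).le).mpr fun x => ?_)
      (half_lt_self hε)
    rw [Subtype.dist_eq, dist_eq_norm]
    refine norm_sub_le_of_mem_realization (f x).2 (hg₀K x) (half_pos hε).le fun v => ?_
    refine le_trans ?_ hκε
    rw [hg₀]
    have hS1 := sum_le_one_of_mem_realization (f x).2
    by_cases hv : v ∈ S
    · have h6 := abs_sub_div_sum_le (a := fun v => (f x).1 v) (y := fun v => h v x) (κ := κ)
        (η := η) (hm0 x) (hm1 x) (fun v hv => hfm v hv x) (fun v _ => hf0 v x)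
        (by rw [abs_le]; constructor <;> linarith [hS x, hS1 S])
        (fun v hv => by simp only [hh v hv]; exact h2' ⟨v, hv⟩ x) (hY1 x) v hv
      rwa [mul_div_cancel₀ _ (by positivity), ← two_mul] at h6
    · have h6 := hS1 (insert v S)
      rw [Finset.sum_insert hv] at h6
      rw [show h v x = 0 by simp [h, hv], zero_div, sub_zero, abs_of_nonneg (hf0 v x)]
      linarith [hS x]
  · refine isKrasinkiewiczMap_of_determines g (fun v : S => h' v) (fun x y => ⟨fun hxy v => ?_,
      fun hxy => Subtype.ext (lp.ext (funext fun v => ?_))⟩) h5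
    · have h6 := eq_of_div_sum_eq (S := S) (fun v => h1 v x) (fun v => h1 v y) (hone x) (hone y)
        (fun v _ => by
          have h7 : g₀ x = g₀ y := congrArg Subtype.val hxy
          change h v x / Y x = h v y / Y y
          rw [← hg₀, ← hg₀, h7]) v v.2
      rwa [hh v v.2] at h6
    · have h6 : ∀ v, h v x = h v y := fun v => by
        by_cases hv : v ∈ S
        · rw [hh v hv]
          exact hxy ⟨v, hv⟩
        · simp [h, hv]
      change g₀ x v = g₀ y v
      simp only [hg₀, Y, h6]
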